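/- Consider four point masses $m_1,m_2,m_3,m_4>0$ in the plane, with positions $q=(q_1,\dots,q_4)\in(\mathbb{R}^2)^4$, Newtonian potential $U(q)=\sum_{i<j} m_i m_j/\|q_i-q_j\|$ and moment of inertia $I(q)=\tfrac12\sum_i m_i\|q_i\|^2$. A central configuration is a collision-free $q$ with $\sum_i m_i q_i=0$ such that $\nabla U(q)+\lambda\nabla I(q)=0$ for some $\lambda\in\mathbb{R}$. It is trapezoidal if the four bodies are the vertices of a convex quadrilateral (no body lies in the convex hull of the other three) having at least one pair of parallel opposite sides (parallelograms are allowed). Then for each choice of the masses and each cyclic ordering of the bodies along the boundary of the quadrilateral (read in either direction), there is at most one trapezoidal central configuration up to rotation, reflection and dilation: if $q$ and $q'$ are trapezoidal central configurations of the masses $m_1,\dots,m_4$ in which the bodies follow each other in the same cyclic order, then there are a linear isometry $A$ of $\mathbb{R}^2$ and a $c>0$ with $q_i'=c\,A q_i$ for $i=1,\dots,4$. -/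

import Mathlib

open scoped Affine

/-- Configurations of `n` point masses in `ℝ^d`, with the Euclidean structure of `ℝ^(n d)`. -/
abbrev Configuration (n d : ℕ) : Type :=
  PiLp 2 (fun _ : Fin n => EuclideanSpace ℝ (Fin d))

/-- The Newtonian potential `∑_{i < j} m_i m_j / ‖q_i - q_j‖`. -/
noncomputable def newtonPotential {n d : ℕ} (m : Fin n → ℝ) (q : Configuration n d) : ℝ :=
  ∑ i, ∑ j ∈ Finset.Ioi i, m i * m j / ‖q i - q j‖

/-- The moment of inertia `(1/2) ∑ m_i ‖q_i‖²`. -/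
noncomputable def momentOfInertia {n d : ℕ} (m : Fin n → ℝ) (q : Configuration n d) : ℝ :=
  (1 / 2) * ∑ i, m i * ‖q i‖ ^ 2

/-- A central configuration: a collision-free configuration, with centre of mass at the origin,
at which `∇U + lam ∇I = 0` for some multiplier `lam`. -/
structure IsCentralConfiguration {n d : ℕ} (m : Fin n → ℝ) (q : Configuration n d) : Prop where
  collision_free : ∀ i j, i ≠ j → q i ≠ q j
  center_of_mass : ∑ i, m i • q i = 0
  critical : ∃ lam : ℝ,
    gradient (newtonPotential m) q + lam • gradient (momentOfInertia m) q = 0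

/-- `p 0, p 1, p 2, p 3` are the vertices of a (nondegenerate) trapezoid, numbered consecutively
along its boundary, in either direction: the points form a convex quadrilateral with diagonals
`p 0 p 2` and `p 1 p 3`, and at least one of the two pairs of opposite sides is parallel
(parallelograms are included). -/
structure IsTrapezoid (p : Fin 4 → EuclideanSpace ℝ (Fin 2)) : Prop where
  convex : ∀ i, p i ∉ convexHull ℝ (p '' {i}ᶜ)
  diagonals_meet : (segment ℝ (p 0) (p 2) ∩ segment ℝ (p 1) (p 3)).Nonempty
  parallel_sides :
    line[ℝ, p 0, p 1] ∥ line[ℝ, p 2, p 3] ∨ line[ℝ, p 1, p 2] ∥ line[ℝ, p 3, p 0]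

/-- A trapezoidal central configuration of the masses `m` in which the bodies follow each other
along the boundary of the trapezoid in the cyclic order `σ 0, σ 1, σ 2, σ 3`. -/
def IsTrapezoidalCC (m : Fin 4 → ℝ) (σ : Equiv.Perm (Fin 4)) (q : Configuration 4 2) : Prop :=
  IsCentralConfiguration m q ∧ IsTrapezoid (fun k => q (σ k))

/-- Two configurations are equivalent if one is the image of the other under a rotation or
reflection followed by a dilation. -/
def ConfigEquiv {n d : ℕ} (q q' : Configuration n d) : Prop :=
  ∃ (A : EuclideanSpace ℝ (Fin d) ≃ₗᵢ[ℝ] EuclideanSpace ℝ (Fin d)) (c : ℝ),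
    0 < c ∧ ∀ i, q' i = c • A (q i)

/-! With S_r = 1/r³ - `lam` for each mutual distance r, a trapezoidal central configuration solves
the equations of `TrapezoidSystem`, where x, y are the bases, p, q the legs and d, e the diagonals.

Suppose two configurations have the same pair of parallel sides, and rescale them to a common `lam`.
Compare the amended potentials ∑ m_i m_j (1/r + `lam` r²/2), expanding legs and diagonals in r² and
bases in log r. The relation d² + e² = p² + q² + 2xy makes the first-order terms sum to something
nonnegative, so the second potential exceeds the first by at least a sum of convexity remainders
(`energy_add_gap_le`). Exchanging the roles forces every remainder to vanish (`sides_eq`).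

If the parallel sides differ, use that the masses at the ends of a longer base exceed the opposite
ones (`mass_lt_of_lt`). For unequal bases, one trapezoid gives m₁ - m₃ and m₂ - m₄ the same sign and
the other gives them opposite signs. So one of the two is a parallelogram, which can be read along
either pair of sides, and the first case applies. -/

/-! ### The distance equations and their symmetries. -/

/-- The Dziobek equations of a trapezoidal central configuration of the masses `m₁, m₂, m₃, m₄`
placed at `(0, 0)`, `(x, 0)`, `(u + y, h)`, `(u, h)`. -/
structure TrapezoidSystem (m₁ m₂ m₃ m₄ lam : ℝ) where
  x : ℝ
  y : ℝ
  p : ℝ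
  q : ℝ
  d : ℝ
  e : ℝ
  u : ℝ
  h : ℝ
  P : ℝ
  x_pos : 0 < x
  y_pos : 0 < y
  p_pos : 0 < p
  q_pos : 0 < q
  d_pos : 0 < d
  e_pos : 0 < e
  h_pos : 0 < h
  p_sq : p ^ 2 = u ^ 2 + h ^ 2
  q_sq : q ^ 2 = (u + y - x) ^ 2 + h ^ 2
  d_sq : d ^ 2 = (u + y) ^ 2 + h ^ 2
  e_sq : e ^ 2 = (u - x) ^ 2 + h ^ 2
  eq_p : m₁ * m₄ * (1 / p ^ 3 - lam) = P
  eq_q : m₂ * m₃ * (1 / q ^ 3 - lam) = P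
  eq_d : m₁ * m₃ * (1 / d ^ 3 - lam) = -P
  eq_e : m₂ * m₄ * (1 / e ^ 3 - lam) = -P
  eq_x : m₁ * m₂ * (1 / x ^ 3 - lam) * x = P * y
  eq_y : m₃ * m₄ * (1 / y ^ 3 - lam) * y = P * x

namespace TrapezoidSystem

variable {m₁ m₂ m₃ m₄ lam : ℝ}

/-- Dilation of a trapezoid. -/
noncomputable def scale (T : TrapezoidSystem m₁ m₂ m₃ m₄ lam) (k : ℝ) (hk : 0 < k) :
    TrapezoidSystem m₁ m₂ m₃ m₄ (lam / k ^ 3) where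
  x := k * T.x
  y := k * T.y
  p := k * T.p
  q := k * T.q
  d := k * T.d
  e := k * T.e
  u := k * T.u
  h := k * T.h
  P := T.P / k ^ 3
  x_pos := mul_pos hk T.x_pos
  y_pos := mul_pos hk T.y_pos
  p_pos := mul_pos hk T.p_pos
  q_pos := mul_pos hk T.q_pos
  d_pos := mul_pos hk T.d_pos
  e_pos := mul_pos hk T.e_pos
  h_pos := mul_pos hk T.h_pos
  p_sq := by linear_combination k ^ 2 * T.p_sq
  q_sq := by linear_combination k ^ 2 * T.q_sq
  d_sq := by linear_combination k ^ 2 * T.d_sq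
  e_sq := by linear_combination k ^ 2 * T.e_sq
  eq_p := by rw [← T.eq_p]; have := T.p_pos; field_simp
  eq_q := by rw [← T.eq_q]; have := T.q_pos; field_simp
  eq_d := by rw [← neg_div, ← T.eq_d]; have := T.d_pos; field_simp
  eq_e := by rw [← neg_div, ← T.eq_e]; have := T.e_pos; field_simp
  eq_x := by
    have : T.P / k ^ 3 * (k * T.y) = T.P * T.y / k ^ 2 := by field_simp
    rw [this, ← T.eq_x]; have := T.x_pos; field_simp
  eq_y := by
    have : T.P / k ^ 3 * (k * T.x) = T.P * T.x / k ^ 2 := by field_simp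
    rw [this, ← T.eq_y]; have := T.y_pos; field_simp

/-- The same trapezoid read from its opposite vertex. -/
def rotate (T : TrapezoidSystem m₁ m₂ m₃ m₄ lam) : TrapezoidSystem m₃ m₄ m₁ m₂ lam where
  x := T.y
  y := T.x
  p := T.q
  q := T.p
  d := T.d
  e := T.e
  u := T.u + T.y - T.x
  h := T.h
  P := T.P
  x_pos := T.y_pos
  y_pos := T.x_pos
  p_pos := T.q_pos
  q_pos := T.p_pos
  d_pos := T.d_pos
  e_pos := T.e_pos
  h_pos := T.h_pos
  p_sq := T.q_sq
  q_sq := by linear_combination T.p_sq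
  d_sq := by linear_combination T.d_sq
  e_sq := by linear_combination T.e_sq
  eq_p := by linear_combination T.eq_q
  eq_q := by linear_combination T.eq_p
  eq_d := by linear_combination T.eq_d
  eq_e := by linear_combination T.eq_e
  eq_x := T.eq_y
  eq_y := T.eq_x

/-- The same trapezoid read in the opposite direction. -/
def reflect (T : TrapezoidSystem m₁ m₂ m₃ m₄ lam) : TrapezoidSystem m₂ m₁ m₄ m₃ lam where
  x := T.x
  y := T.y
  p := T.q
  q := T.p
  d := T.e
  e := T.d
  u := T.x - T.y - T.u
  h := T.h
  P := T.P
  x_pos := T.x_pos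
  y_pos := T.y_pos
  p_pos := T.q_pos
  q_pos := T.p_pos
  d_pos := T.e_pos
  e_pos := T.d_pos
  h_pos := T.h_pos
  p_sq := by linear_combination T.q_sq
  q_sq := by linear_combination T.p_sq
  d_sq := by linear_combination T.e_sq
  e_sq := by linear_combination T.d_sq
  eq_p := T.eq_q
  eq_q := T.eq_p
  eq_d := T.eq_e
  eq_e := T.eq_d
  eq_x := by linear_combination T.eq_x
  eq_y := by linear_combination T.eq_y

/-! ### The masses at the longer base. -/

theorem diagonals_sq (T : TrapezoidSystem m₁ m₂ m₃ m₄ lam) :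
    T.d ^ 2 + T.e ^ 2 = T.p ^ 2 + T.q ^ 2 + 2 * T.x * T.y := by
  linear_combination T.d_sq + T.e_sq - T.p_sq - T.q_sq

theorem inv_cube_le_iff {a b : ℝ} (ha : 0 < a) (hb : 0 < b) : 1 / a ^ 3 ≤ 1 / b ^ 3 ↔ b ≤ a := by
  rw [one_div_le_one_div (by positivity) (by positivity)]
  exact pow_le_pow_iff_left₀ hb.le ha.le (by norm_num)

theorem inv_cube_lt_iff {a b : ℝ} (ha : 0 < a) (hb : 0 < b) : 1 / a ^ 3 < 1 / b ^ 3 ↔ b < a := by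
  rw [← not_le, inv_cube_le_iff hb ha, not_le]

/-- To first order in 1 - y the hypothesis gives p² ≤ 1 - (14/9)(1 - y), and that of
`le_mul_sq_of_le_cube` gives y q² ≥ 1 - (13/9)(1 - y). The slope 3/2 is midway, and 13/10 - 3/10 =
1, so that together the two bounds contradict y q² < p² - (1 - y)² in `mass_lt_of_x_eq_one`. -/
theorem sq_le_of_cube_le {y p : ℝ} (hy0 : 0 < y) (hy : y < 1) (hp : 0 < p)
    (h : p ^ 3 * (1 + y ^ 2 * (1 - y) / 3) ≤ y ^ 2) :
    p ^ 2 ≤ 1 - 3 / 2 * (1 - y) + 13 / 10 * (1 - y) ^ 2 := by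
  by_contra! hf
  obtain ⟨E, hE⟩ : ∃ E, E = 1 - y := ⟨_, rfl⟩
  rw [← hE] at h hf
  have hE0 : 0 < E := by linarith
  have hf0 : 0 < 1 - 3 / 2 * E + 13 / 10 * E ^ 2 := by nlinarith [sq_nonneg (E - 1 / 2)]
  have h3 : (1 - 3 / 2 * E + 13 / 10 * E ^ 2) ^ 3 < (p ^ 2) ^ 3 :=
    pow_lt_pow_left₀ hf hf0.le (by norm_num)
  have h4 : (p ^ 3 * (1 + y ^ 2 * E / 3)) ^ 2 ≤ (y ^ 2) ^ 2 :=
    pow_le_pow_left₀ (by positivity) h 2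
  have h5 := mul_lt_mul_of_pos_right h3 (by positivity : 0 < (1 + y ^ 2 * E / 3) ^ 2)
  -- Homogenised by E + y = 1, the difference becomes a form with positive coefficients.
  have key : 0 < E * (
      1/6 * y ^ 12 +
        437/180 * E * y ^ 11 +
        6283/360 * E ^ 2 * y ^ 10 +
        40267/600 * E ^ 3 * y ^ 9 +
        140117/900 * E ^ 4 * y ^ 8 +
        1083139/4500 * E ^ 5 * y ^ 7 +
        792511/3000 * E ^ 6 * y ^ 6 +
        1925093/9000 * E ^ 7 * y ^ 5 +
        1175489/9000 * E ^ 8 * y ^ 4 +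
        180751/3000 * E ^ 9 * y ^ 3 +
        61/3 * E ^ 10 * y ^ 2 +
        568/125 * E ^ 11 * y +
        64/125 * E ^ 12) := by positivity
  have id : (1 - 3 / 2 * E + 13 / 10 * E ^ 2) ^ 3 * (1 + y ^ 2 * E / 3) ^ 2 - y ^ 4 = E * (
      1/6 * y ^ 12 +
        437/180 * E * y ^ 11 +
        6283/360 * E ^ 2 * y ^ 10 +
        40267/600 * E ^ 3 * y ^ 9 +
        140117/900 * E ^ 4 * y ^ 8 +
        1083139/4500 * E ^ 5 * y ^ 7 +
        792511/3000 * E ^ 6 * y ^ 6 +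
        1925093/9000 * E ^ 7 * y ^ 5 +
        1175489/9000 * E ^ 8 * y ^ 4 +
        180751/3000 * E ^ 9 * y ^ 3 +
        61/3 * E ^ 10 * y ^ 2 +
        568/125 * E ^ 11 * y +
        64/125 * E ^ 12) := by
    obtain rfl : y = 1 - E := by linarith
    ring
  nlinarith

theorem le_mul_sq_of_le_cube {y q : ℝ} (hy0 : 0 < y) (hy : y < 1) (hq : 0 < q)
    (h : 3 * y ≤ q ^ 3 * (y + 2)) :
    1 - 3 / 2 * (1 - y) + 3 / 10 * (1 - y) ^ 2 ≤ y * q ^ 2 := by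
  by_contra! hg
  obtain ⟨E, hE⟩ : ∃ E, E = 1 - y := ⟨_, rfl⟩
  -- The negated bound makes the quadratic positive, so E is below its smaller root, about 0.792; in
  -- E and z = 4/5 - E > 0 the certificate has positive coefficients.
  obtain ⟨z, hz⟩ : ∃ z, z = 4 / 5 - E := ⟨_, rfl⟩
  rw [← hE] at hg
  have hE0 : 0 < E := by linarith
  have hg0 : 0 < y * q ^ 2 := by positivity
  have hz0 : 0 < z := by nlinarith
  have h3 : (y * q ^ 2) ^ 3 < (1 - 3 / 2 * E + 3 / 10 * E ^ 2) ^ 3 :=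
    pow_lt_pow_left₀ hg hg0.le (by norm_num)
  have h4 : (3 * y) ^ 2 ≤ (q ^ 3 * (y + 2)) ^ 2 := pow_le_pow_left₀ (by positivity) h 2
  have h5 := mul_lt_mul_of_pos_right h3 (by positivity : 0 < (y + 2) ^ 2)
  have h6 := mul_le_mul_of_nonneg_left h4 (by positivity : 0 ≤ y ^ 3)
  have key : 0 < E * (
      1171875/131072 * z ^ 8 +
        2546875/65536 * E * z ^ 7 +
        5190625/65536 * E ^ 2 * z ^ 6 +
        6520875/65536 * E ^ 3 * z ^ 5 +
        324275/4096 * E ^ 4 * z ^ 4 +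
        2393321/65536 * E ^ 5 * z ^ 3 +
        2675619/327680 * E ^ 6 * z ^ 2 +
        1010569/1638400 * E ^ 7 * z +
        70373/3276800 * E ^ 8) := by positivity
  have id : 9 * y ^ 5 - (1 - 3 / 2 * E + 3 / 10 * E ^ 2) ^ 3 * (y + 2) ^ 2 = E * (
      1171875/131072 * z ^ 8 +
        2546875/65536 * E * z ^ 7 +
        5190625/65536 * E ^ 2 * z ^ 6 +
        6520875/65536 * E ^ 3 * z ^ 5 +
        324275/4096 * E ^ 4 * z ^ 4 +
        2393321/65536 * E ^ 5 * z ^ 3 +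
        2675619/327680 * E ^ 6 * z ^ 2 +
        1010569/1638400 * E ^ 7 * z +
        70373/3276800 * E ^ 8) := by
    obtain rfl : y = 1 - E := by linarith
    rw [hz]
    ring
  nlinarith

section Positive

variable (T : TrapezoidSystem m₁ m₂ m₃ m₄ lam) (h₁ : 0 < m₁) (h₂ : 0 < m₂) (h₃ : 0 < m₃)
  (h₄ : 0 < m₄)
include T h₁ h₂ h₃ h₄

/-- Otherwise d ≤ p and e ≤ q, against `diagonals_sq`. -/
theorem P_pos : 0 < T.P := by
  by_contra! hP
  have hp : 1 / T.p ^ 3 - lam ≤ 0 := by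
    by_contra! h
    have := T.eq_p
    have : 0 < m₁ * m₄ * (1 / T.p ^ 3 - lam) := by positivity
    linarith
  have hq : 1 / T.q ^ 3 - lam ≤ 0 := by
    by_contra! h
    have := T.eq_q
    have : 0 < m₂ * m₃ * (1 / T.q ^ 3 - lam) := by positivity
    linarith
  have hd : 0 ≤ 1 / T.d ^ 3 - lam := by
    refine nonneg_of_mul_nonneg_right ?_ (mul_pos h₁ h₃)
    rw [T.eq_d]; linarith
  have he : 0 ≤ 1 / T.e ^ 3 - lam := by
    refine nonneg_of_mul_nonneg_right ?_ (mul_pos h₂ h₄)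
    rw [T.eq_e]; linarith
  have h1 : T.d ≤ T.p := (inv_cube_le_iff T.p_pos T.d_pos).1 (by linarith)
  have h2 : T.e ≤ T.q := (inv_cube_le_iff T.q_pos T.e_pos).1 (by linarith)
  have h3 := pow_le_pow_left₀ T.d_pos.le h1 2
  have h4 := pow_le_pow_left₀ T.e_pos.le h2 2
  have h5 := T.diagonals_sq
  have := mul_pos T.x_pos T.y_pos
  linarith

theorem S_p_pos : lam < 1 / T.p ^ 3 := by
  have := T.P_pos h₁ h₂ h₃ h₄
  rw [← T.eq_p] at this
  linarith [pos_of_mul_pos_right this (mul_pos h₁ h₄).le]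

theorem S_q_pos : lam < 1 / T.q ^ 3 := T.reflect.S_p_pos h₂ h₁ h₄ h₃

theorem S_d_neg : 1 / T.d ^ 3 < lam := by
  have := T.P_pos h₁ h₂ h₃ h₄
  have h : 0 < m₁ * m₃ * (lam - 1 / T.d ^ 3) := by linarith [T.eq_d]
  linarith [pos_of_mul_pos_right h (mul_pos h₁ h₃).le]

theorem S_e_neg : 1 / T.e ^ 3 < lam := T.reflect.S_d_neg h₂ h₁ h₄ h₃

theorem S_x_pos : lam < 1 / T.x ^ 3 := by
  have := mul_pos (T.P_pos h₁ h₂ h₃ h₄) T.y_pos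
  rw [← T.eq_x] at this
  linarith [pos_of_mul_pos_right (pos_of_mul_pos_left this T.x_pos.le) (mul_pos h₁ h₂).le]

theorem lam_pos : 0 < lam := lt_trans (by have := T.d_pos; positivity) (T.S_d_neg h₁ h₂ h₃ h₄)

theorem mul_S_legs : (1 / T.p ^ 3 - lam) * (1 / T.q ^ 3 - lam) =
    (1 / T.x ^ 3 - lam) * (1 / T.y ^ 3 - lam) := by
  have hx := T.x_pos
  have hy := T.y_pos
  have hM : m₁ * m₂ * m₃ * m₄ * (T.x * T.y) ≠ 0 := by positivity
  apply mul_left_cancel₀ hM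
  linear_combination T.x * T.y * (m₂ * m₃ * (1 / T.q ^ 3 - lam) * T.eq_p + T.P * T.eq_q) -
    (m₃ * m₄ * (1 / T.y ^ 3 - lam) * T.y * T.eq_x + T.P * T.y * T.eq_y)

theorem q_lt_x (hxy : T.y < T.x) : T.q < T.x := by
  by_contra! h
  have h1 := (inv_cube_le_iff T.q_pos T.x_pos).2 h
  have hq := T.S_q_pos h₁ h₂ h₃ h₄
  have hp := T.S_p_pos h₁ h₂ h₃ h₄
  have h2 : 1 / T.y ^ 3 ≤ 1 / T.p ^ 3 := by
    by_contra! h3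
    have := T.mul_S_legs h₁ h₂ h₃ h₄
    have h4 : (1 / T.q ^ 3 - lam) * (1 / T.p ^ 3 - lam) <
        (1 / T.x ^ 3 - lam) * (1 / T.y ^ 3 - lam) :=
      mul_lt_mul' (by linarith) (by linarith) (by linarith) (by linarith)
    linarith
  have h5 : T.p ≤ T.y := (inv_cube_le_iff T.y_pos T.p_pos).1 h2
  -- Translating one leg gives a nondegenerate triangle with sides p, q and x - y, so this violates
  -- the triangle inequality.
  have h6 : T.p + (T.x - T.y) ≤ T.q := by linarith
  have h7 := pow_le_pow_left₀ (by linarith [T.p_pos]) h6 2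
  have h8 : -T.p < T.u := (abs_lt.1 (abs_lt_of_sq_lt_sq (by nlinarith [T.p_sq, T.h_pos])
    T.p_pos.le)).1
  have h9 := mul_pos (sub_pos.2 hxy) (by linarith : 0 < T.u + T.p)
  nlinarith [T.q_sq, T.p_sq]

theorem p_lt_x (hxy : T.y < T.x) : T.p < T.x := T.reflect.q_lt_x h₂ h₁ h₄ h₃ hxy

/-- Both legs are shorter than 1, so d² + e² < 4 and some diagonal r has r² < 2. Now `lam` > 1/r³
and 2^(3/2) < 3. -/
theorem one_third_lt_lam (hx : T.x = 1) (hy : T.y < 1) : 1 / 3 < lam := by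
  have hp := T.p_lt_x h₁ h₂ h₃ h₄ (hx ▸ hy)
  have hq := T.q_lt_x h₁ h₂ h₃ h₄ (hx ▸ hy)
  have hd := T.S_d_neg h₁ h₂ h₃ h₄
  have he := T.S_e_neg h₁ h₂ h₃ h₄
  have key : ∀ r : ℝ, 0 < r → r ^ 2 < 2 → 1 / 3 < 1 / r ^ 3 := by
    intro r hr h
    have : r < 1.42 := by nlinarith
    exact one_div_lt_one_div_of_lt (by positivity) (by nlinarith)
  rw [hx] at hp hq
  have hp2 : T.p ^ 2 < 1 := by nlinarith [T.p_pos]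
  have hq2 : T.q ^ 2 < 1 := by nlinarith [T.q_pos]
  have hs := T.diagonals_sq
  rw [hx] at hs
  rcases lt_or_ge (T.d ^ 2) 2 with h | h
  · exact (key _ T.d_pos h).trans hd
  · exact (key _ T.e_pos (by linarith)).trans he

/-- If m₁ ≤ m₃, comparing base and leg equations gives y S_y ≤ S_p and y S_q ≤ S_x. As `lam` > 1/3,
these bound p above and q below, incompatibly with d > x. -/
theorem mass_lt_of_x_eq_one (hx : T.x = 1) (hy : T.y < 1) : m₃ < m₁ := by
  by_contra! hm
  have hlam := T.one_third_lt_lam h₁ h₂ h₃ h₄ hx hy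
  have hSp := T.S_p_pos h₁ h₂ h₃ h₄
  have hSx := T.S_x_pos h₁ h₂ h₃ h₄
  have hSd := T.S_d_neg h₁ h₂ h₃ h₄
  have hd : T.x < T.d := (inv_cube_lt_iff T.d_pos T.x_pos).1 (hSd.trans hSx)
  have hy0 := T.y_pos
  have hp0 := T.p_pos
  have hq0 := T.q_pos
  have hd2 := T.d_sq
  have hp2 := T.p_sq
  have hq2 := T.q_sq
  have ex := T.eq_x
  have ey := T.eq_y
  have ep := T.eq_p
  have eq := T.eq_q
  rw [hx] at hd hSx ex ey hq2
  generalize T.x = x at *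
  generalize T.y = y at *
  generalize T.p = p at *
  generalize T.q = q at *
  generalize T.d = d at *
  have hd1 : 1 < d ^ 2 := by nlinarith
  -- Stewart's theorem in the triangle of bodies 1, 2, 3, with the cevian parallel to the leg p: y
  -- q² + (1 - y) d² = p² + y (1 - y).
  have hq3 : y * q ^ 2 < p ^ 2 - (1 - y) ^ 2 := by
    have : 0 < (1 - y) * (d ^ 2 - 1) := mul_pos (by linarith) (by linarith)
    rw [hd2] at this
    rw [hq2, hp2]
    linarith
  have h34 : m₃ * ((1 / y ^ 3 - lam) * y) = m₁ * (1 / p ^ 3 - lam) := by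
    apply mul_left_cancel₀ h₄.ne'
    linear_combination ey - ep
  have hS34 : (1 / y ^ 3 - lam) * y ≤ 1 / p ^ 3 - lam := by
    refine le_of_mul_le_mul_left ?_ h₃
    rw [h34]
    exact mul_le_mul_of_nonneg_right hm (by linarith)
  have h12 : m₁ * (1 - lam) = m₃ * ((1 / q ^ 3 - lam) * y) := by
    apply mul_left_cancel₀ h₂.ne'
    linear_combination ex - y * eq
  have hS12 : (1 / q ^ 3 - lam) * y ≤ 1 - lam := by
    refine le_of_mul_le_mul_left ?_ h₃
    rw [← h12]
    exact mul_le_mul_of_nonneg_right hm (by linarith)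
  have hlam' : 0 < (lam - 1 / 3) * (1 - y) := mul_pos (by linarith) (by linarith)
  have hp4 : p ^ 3 * (1 + y ^ 2 * (1 - y) / 3) ≤ y ^ 2 := by
    have e1 : (1 / y ^ 3 - lam) * y = 1 / y ^ 2 - lam * y := by field_simp
    have h1 : 1 / y ^ 2 + (1 - y) / 3 ≤ 1 / p ^ 3 := by
      rw [e1] at hS34
      linarith
    have h2 := mul_le_mul_of_nonneg_left h1 (by positivity : 0 ≤ p ^ 3 * y ^ 2)
    have e2 : p ^ 3 * y ^ 2 * (1 / p ^ 3) = y ^ 2 := by field_simp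
    have e3 : p ^ 3 * y ^ 2 * (1 / y ^ 2 + (1 - y) / 3) =
      p ^ 3 * (1 + y ^ 2 * (1 - y) / 3) := by field_simp
    linarith
  have hq4 : 3 * y ≤ q ^ 3 * (y + 2) := by
    have h1 : 1 / q ^ 3 * y ≤ (y + 2) / 3 := by linarith
    have h2 := mul_le_mul_of_nonneg_left h1 (by positivity : 0 ≤ 3 * q ^ 3)
    have e2 : 3 * q ^ 3 * (1 / q ^ 3 * y) = 3 * y := by field_simp
    linarith
  have hf := sq_le_of_cube_le hy0 hy hp0 hp4
  have hg := le_mul_sq_of_le_cube hy0 hy hq0 hq4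
  linarith

/-- The masses at the ends of the longer base exceed those at the opposite vertices. -/
theorem mass_lt_of_lt (hxy : T.y < T.x) : m₃ < m₁ ∧ m₄ < m₂ := by
  have hx := T.x_pos
  have e : (T.scale (1 / T.x) (by positivity)).x = 1 := one_div_mul_cancel hx.ne'
  have hy : (T.scale (1 / T.x) (by positivity)).y < 1 := by
    calc 1 / T.x * T.y < 1 / T.x * T.x := mul_lt_mul_of_pos_left hxy (by positivity)
      _ = 1 := e
  exact ⟨mass_lt_of_x_eq_one _ h₁ h₂ h₃ h₄ e hy,
    mass_lt_of_x_eq_one (T.scale (1 / T.x) (by positivity)).reflect h₂ h₁ h₄ h₃ e hy⟩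

end Positive

/-! ### Uniqueness for a given multiplier, by convexity. -/

/-- The remainder of `1 / b` over its tangent at `a` in the variable `b ^ 2`. -/
noncomputable def sqGap (a b : ℝ) : ℝ := 1 / b - 1 / a + (b ^ 2 - a ^ 2) / (2 * a ^ 3)

/-- The remainder of `1 / b` over its tangent at `a` in the variable `log b`. -/
noncomputable def logGap (a b : ℝ) : ℝ := 1 / b - 1 / a + Real.log (b / a) / a

theorem sqGap_eq {a b : ℝ} (ha : 0 < a) (hb : 0 < b) :
    sqGap a b = (b - a) ^ 2 * (b + 2 * a) / (2 * a ^ 3 * b) := by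
  unfold sqGap
  field_simp
  ring

theorem sqGap_nonneg {a b : ℝ} (ha : 0 < a) (hb : 0 < b) : 0 ≤ sqGap a b := by
  rw [sqGap_eq ha hb]
  positivity

theorem eq_of_sqGap_nonpos {a b : ℝ} (ha : 0 < a) (hb : 0 < b) (h : sqGap a b ≤ 0) : b = a := by
  by_contra hab
  have := sub_ne_zero.2 hab
  rw [sqGap_eq ha hb] at h
  exact h.not_gt (by positivity)

theorem logGap_eq {a b : ℝ} (ha : 0 < a) (hb : 0 < b) :
    logGap a b = (a / b - 1 - Real.log (a / b)) / a := by
  rw [logGap, ← inv_div a b, Real.log_inv]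
  field_simp
  ring

theorem logGap_nonneg {a b : ℝ} (ha : 0 < a) (hb : 0 < b) : 0 ≤ logGap a b := by
  rw [logGap_eq ha hb]
  have := Real.log_le_sub_one_of_pos (div_pos ha hb)
  exact div_nonneg (by linarith) ha.le

theorem eq_of_logGap_nonpos {a b : ℝ} (ha : 0 < a) (hb : 0 < b) (h : logGap a b ≤ 0) : b = a := by
  by_contra hab
  have h1 : a / b ≠ 1 := fun h => hab ((div_eq_one_iff_eq hb.ne').1 h).symm
  have := Real.log_lt_sub_one_of_pos (div_pos ha hb) h1
  rw [logGap_eq ha hb] at h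
  exact h.not_gt (div_pos (by linarith) ha)

/-- The amended potential of the configuration. -/
noncomputable def energy (T : TrapezoidSystem m₁ m₂ m₃ m₄ lam) : ℝ :=
  m₁ * m₂ * (1 / T.x + lam / 2 * T.x ^ 2) + m₃ * m₄ * (1 / T.y + lam / 2 * T.y ^ 2) +
  m₁ * m₄ * (1 / T.p + lam / 2 * T.p ^ 2) + m₂ * m₃ * (1 / T.q + lam / 2 * T.q ^ 2) +
  m₁ * m₃ * (1 / T.d + lam / 2 * T.d ^ 2) + m₂ * m₄ * (1 / T.e + lam / 2 * T.e ^ 2)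

/-- The total remainder of the potential over its tangent. -/
noncomputable def gap (T T' : TrapezoidSystem m₁ m₂ m₃ m₄ lam) : ℝ :=
  m₁ * m₂ * logGap T.x T'.x + m₃ * m₄ * logGap T.y T'.y + m₁ * m₄ * sqGap T.p T'.p +
  m₂ * m₃ * sqGap T.q T'.q + m₁ * m₃ * sqGap T.d T'.d + m₂ * m₄ * sqGap T.e T'.e

theorem energy_term_sq {M a b : ℝ} (ha : 0 < a) (hb : 0 < b) :
    M * (1 / b + lam / 2 * b ^ 2) = M * (1 / a + lam / 2 * a ^ 2) + M * sqGap a b -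
      M * (1 / a ^ 3 - lam) / 2 * (b ^ 2 - a ^ 2) := by
  unfold sqGap
  field_simp
  ring

/-- The term in r² is also convex in log r; its remainder is dropped, hence an inequality where
`energy_term_sq` is an identity. -/
theorem energy_term_log {M a b : ℝ} (hM : 0 < M) (hlam : 0 < lam) (ha : 0 < a) (hb : 0 < b) :
    M * (1 / a + lam / 2 * a ^ 2) + M * logGap a b -
      M * (1 / a ^ 3 - lam) * a ^ 2 * Real.log (b / a) ≤ M * (1 / b + lam / 2 * b ^ 2) := by
  have h := Real.log_le_sub_one_of_pos (show 0 < (b / a) ^ 2 by positivity)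
  rw [Real.log_pow] at h
  have h2 := mul_le_mul_of_nonneg_left h (show 0 ≤ M * lam / 2 * a ^ 2 by positivity)
  have e1 : M * lam / 2 * a ^ 2 * ((b / a) ^ 2 - 1) = M * lam / 2 * (b ^ 2 - a ^ 2) := by
    field_simp
  have e2 : M * (1 / a ^ 3 - lam) * a ^ 2 * Real.log (b / a) =
      M * (Real.log (b / a) / a) - M * lam * a ^ 2 * Real.log (b / a) := by
    field_simp
  rw [e1] at h2
  push_cast at h2
  unfold logGap
  linarith

section Positive

variable (T T' : TrapezoidSystem m₁ m₂ m₃ m₄ lam) (h₁ : 0 < m₁) (h₂ : 0 < m₂) (h₃ : 0 < m₃)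
  (h₄ : 0 < m₄)
include h₁ h₂ h₃ h₄

/-- At `T` the slopes are -P/2 for legs and P/2 for diagonals in squared length, and -Pxy for bases
in log length. By `diagonals_sq` the first-order terms add up to P(x'y' - xy) - Pxy log(x'y'/xy),
which is nonnegative since P > 0 and log t ≤ t - 1. -/
theorem energy_add_gap_le : T.energy + T.gap T' ≤ T'.energy := by
  have hlam := T.lam_pos h₁ h₂ h₃ h₄
  have hP := T.P_pos h₁ h₂ h₃ h₄
  have hx := T.x_pos
  have hy := T.y_pos
  have hx' := T'.x_pos
  have hy' := T'.y_pos
  have tx := energy_term_log (mul_pos h₁ h₂) hlam hx hx'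
  have ty := energy_term_log (mul_pos h₃ h₄) hlam hy hy'
  have tp := energy_term_sq (lam := lam) (M := m₁ * m₄) T.p_pos T'.p_pos
  have tq := energy_term_sq (lam := lam) (M := m₂ * m₃) T.q_pos T'.q_pos
  have td := energy_term_sq (lam := lam) (M := m₁ * m₃) T.d_pos T'.d_pos
  have te := energy_term_sq (lam := lam) (M := m₂ * m₄) T.e_pos T'.e_pos
  rw [T.eq_p] at tp
  rw [T.eq_q] at tq
  rw [T.eq_d] at td
  rw [T.eq_e] at te
  have ex : m₁ * m₂ * (1 / T.x ^ 3 - lam) * T.x ^ 2 = T.P * (T.x * T.y) := by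
    linear_combination T.x * T.eq_x
  have ey : m₃ * m₄ * (1 / T.y ^ 3 - lam) * T.y ^ 2 = T.P * (T.x * T.y) := by
    linear_combination T.y * T.eq_y
  rw [ex] at tx
  rw [ey] at ty
  have hlog : T.P * (T.x * T.y) * Real.log (T'.x / T.x) +
      T.P * (T.x * T.y) * Real.log (T'.y / T.y) ≤ T.P * (T'.x * T'.y - T.x * T.y) := by
    have hl := Real.log_le_sub_one_of_pos (mul_pos (div_pos hx' hx) (div_pos hy' hy))
    rw [Real.log_mul (by positivity) (by positivity)] at hl
    have := mul_le_mul_of_nonneg_left hl (show 0 ≤ T.P * (T.x * T.y) by positivity)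
    have e : T.P * (T.x * T.y) * (T'.x / T.x * (T'.y / T.y) - 1) =
        T.P * (T'.x * T'.y - T.x * T.y) := by field_simp
    linarith
  have hdiag : T.P * (T.d ^ 2 + T.e ^ 2) = T.P * (T.p ^ 2 + T.q ^ 2 + 2 * T.x * T.y) := by
    rw [T.diagonals_sq]
  have hdiag' : T.P * (T'.d ^ 2 + T'.e ^ 2) = T.P * (T'.p ^ 2 + T'.q ^ 2 + 2 * T'.x * T'.y) := by
    rw [T'.diagonals_sq]
  unfold energy gap
  linarith

theorem gap_terms_nonneg : 0 ≤ m₁ * m₂ * logGap T.x T'.x ∧ 0 ≤ m₃ * m₄ * logGap T.y T'.y ∧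
    0 ≤ m₁ * m₄ * sqGap T.p T'.p ∧ 0 ≤ m₂ * m₃ * sqGap T.q T'.q ∧
    0 ≤ m₁ * m₃ * sqGap T.d T'.d ∧ 0 ≤ m₂ * m₄ * sqGap T.e T'.e :=
  ⟨mul_nonneg (mul_pos h₁ h₂).le (logGap_nonneg T.x_pos T'.x_pos),
    mul_nonneg (mul_pos h₃ h₄).le (logGap_nonneg T.y_pos T'.y_pos),
    mul_nonneg (mul_pos h₁ h₄).le (sqGap_nonneg T.p_pos T'.p_pos),
    mul_nonneg (mul_pos h₂ h₃).le (sqGap_nonneg T.q_pos T'.q_pos),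
    mul_nonneg (mul_pos h₁ h₃).le (sqGap_nonneg T.d_pos T'.d_pos),
    mul_nonneg (mul_pos h₂ h₄).le (sqGap_nonneg T.e_pos T'.e_pos)⟩

/-- Uniqueness for a given multiplier. -/
theorem sides_eq : T'.x = T.x ∧ T'.y = T.y ∧ T'.p = T.p ∧ T'.e = T.e := by
  have h := T.energy_add_gap_le T' h₁ h₂ h₃ h₄
  have h' := T'.energy_add_gap_le T h₁ h₂ h₃ h₄
  obtain ⟨ax, ay, ap, aq, ad, ae⟩ := T.gap_terms_nonneg T' h₁ h₂ h₃ h₄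
  obtain ⟨bx, byy, bp, bq, bd, be⟩ := T'.gap_terms_nonneg T h₁ h₂ h₃ h₄
  -- Adding the two comparisons cancels the energies: the two gaps sum to at most 0, and both are
  -- nonnegative.
  have key : T.gap T' ≤ 0 := by
    unfold gap at h'
    linarith
  unfold gap at key
  refine ⟨eq_of_logGap_nonpos T.x_pos T'.x_pos ?_, eq_of_logGap_nonpos T.y_pos T'.y_pos ?_,
    eq_of_sqGap_nonpos T.p_pos T'.p_pos ?_, eq_of_sqGap_nonpos T.e_pos T'.e_pos ?_⟩
  · exact nonpos_of_mul_nonpos_right (by linarith) (mul_pos h₁ h₂)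
  · exact nonpos_of_mul_nonpos_right (by linarith) (mul_pos h₃ h₄)
  · exact nonpos_of_mul_nonpos_right (by linarith) (mul_pos h₁ h₄)
  · exact nonpos_of_mul_nonpos_right (by linarith) (mul_pos h₂ h₄)

end Positive

/-! ### Comparison of two systems. -/

/-- Trapezoidal central configurations of the same masses with the same pair of parallel sides
have proportional mutual distances. -/
theorem exists_proportional {lam' : ℝ} (T : TrapezoidSystem m₁ m₂ m₃ m₄ lam)
    (T' : TrapezoidSystem m₁ m₂ m₃ m₄ lam') (h₁ : 0 < m₁) (h₂ : 0 < m₂) (h₃ : 0 < m₃)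
    (h₄ : 0 < m₄) :
    ∃ c, 0 < c ∧ T'.x = c * T.x ∧ T'.y = c * T.y ∧ T'.p = c * T.p ∧ T'.e = c * T.e := by
  have hl := T.lam_pos h₁ h₂ h₃ h₄
  have hl' := T'.lam_pos h₁ h₂ h₃ h₄
  obtain ⟨c, hc, e⟩ : ∃ c, 0 < c ∧ lam / c ^ 3 = lam' := by
    refine ⟨(lam / lam') ^ (1 / 3 : ℝ), by positivity, ?_⟩
    rw [← Real.rpow_natCast, ← Real.rpow_mul (by positivity)]
    norm_num
    field_simp
  subst e
  exact ⟨c, hc, (T.scale c hc).sides_eq T' h₁ h₂ h₃ h₄⟩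

/-- If both pairs of opposite sides can be parallel for the same masses and cyclic order, then
one of the trapezoids is a parallelogram. -/
theorem parallelogram_of_mixed {lam' : ℝ} (T : TrapezoidSystem m₁ m₂ m₃ m₄ lam)
    (T' : TrapezoidSystem m₂ m₃ m₄ m₁ lam') (h₁ : 0 < m₁) (h₂ : 0 < m₂) (h₃ : 0 < m₃)
    (h₄ : 0 < m₄) : T.x = T.y ∨ T'.x = T'.y := by
  by_contra! h
  rcases lt_or_gt_of_ne h.1 with h1 | h1
  · have := T.rotate.mass_lt_of_lt h₃ h₄ h₁ h₂ h1
    rcases lt_or_gt_of_ne h.2 with h2 | h2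
    · have := T'.rotate.mass_lt_of_lt h₄ h₁ h₂ h₃ h2
      linarith
    · have := T'.mass_lt_of_lt h₂ h₃ h₄ h₁ h2
      linarith
  · have := T.mass_lt_of_lt h₁ h₂ h₃ h₄ h1
    rcases lt_or_gt_of_ne h.2 with h2 | h2
    · have := T'.rotate.mass_lt_of_lt h₄ h₁ h₂ h₃ h2
      linarith
    · have := T'.mass_lt_of_lt h₂ h₃ h₄ h₁ h2
      linarith

end TrapezoidSystem

/-! ### From critical points to force equations. -/

theorem hasDerivAt_inv_norm_line {E : Type*} [NormedAddCommGroup E] [InnerProductSpace ℝ E]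
    {a : E} (ha : a ≠ 0) (b : E) :
    HasDerivAt (fun t : ℝ => 1 / ‖a + t • b‖) (-(1 / ‖a‖ ^ 3 * inner ℝ a b)) 0 := by
  have h0 : HasDerivAt (fun t : ℝ => a + t • b) b 0 := by
    simpa using ((hasDerivAt_id (0 : ℝ)).smul_const b).const_add a
  have h1 := h0.norm_sq
  simp only [zero_smul, add_zero] at h1
  have hn : ‖a‖ ≠ 0 := norm_ne_zero_iff.2 ha
  have h2 := (h1.sqrt (by simpa using ha)).fun_inv (by simpa using ha)
  simp only [zero_smul, add_zero, Real.sqrt_sq (norm_nonneg _)] at h2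
  simp_rw [one_div ‖a + _ • b‖]
  exact h2.congr_deriv (by field_simp)

theorem differentiableAt_newtonPotential {n d : ℕ} (m : Fin n → ℝ) {q : Configuration n d}
    (hq : ∀ i j, i ≠ j → q i ≠ q j) : DifferentiableAt ℝ (newtonPotential m) q := by
  unfold newtonPotential
  refine DifferentiableAt.fun_sum fun i _ => DifferentiableAt.fun_sum fun j hj => ?_
  have hne : q i - q j ≠ 0 := sub_ne_zero.2 (hq i j (Finset.mem_Ioi.1 hj).ne)
  have hd : DifferentiableAt ℝ (fun q : Configuration n d => q i - q j) q :=
    ((PiLp.proj 2 (fun _ : Fin n => EuclideanSpace ℝ (Fin d)) i :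
      Configuration n d →L[ℝ] _).differentiableAt).sub
    ((PiLp.proj 2 (fun _ : Fin n => EuclideanSpace ℝ (Fin d)) j :
      Configuration n d →L[ℝ] _).differentiableAt)
  have hn : DifferentiableAt ℝ (fun q : Configuration n d => ‖q i - q j‖) q := hd.norm ℝ hne
  simp_rw [div_eq_mul_inv]
  exact (hn.fun_inv (norm_ne_zero_iff.2 hne)).const_mul _

theorem differentiableAt_momentOfInertia {n d : ℕ} (m : Fin n → ℝ) (q : Configuration n d) :
    DifferentiableAt ℝ (momentOfInertia m) q := by
  unfold momentOfInertia
  refine DifferentiableAt.const_mul (DifferentiableAt.fun_sum fun i _ =>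
    DifferentiableAt.const_mul ?_ _) _
  exact ((PiLp.proj 2 (fun _ : Fin n => EuclideanSpace ℝ (Fin d)) i :
      Configuration n d →L[ℝ] _).differentiableAt).norm_sq ℝ

theorem inner_gradient_eq {F : Type*} [NormedAddCommGroup F] [InnerProductSpace ℝ F]
    [CompleteSpace F] {f : F → ℝ} {q v : F} {f' : ℝ} (hf : DifferentiableAt ℝ f q)
    (h : HasDerivAt (fun t : ℝ => f (q + t • v)) f' 0) : inner ℝ (gradient f q) v = f' := by
  have h0 : HasDerivAt (fun t : ℝ => q + t • v) v 0 := by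
    simpa using ((hasDerivAt_id (0 : ℝ)).smul_const v).const_add q
  have h1 : HasFDerivAt f (fderiv ℝ f q) (q + (0 : ℝ) • v) := by simpa using hf.hasFDerivAt
  have h2 := h1.comp_hasDerivAt (0 : ℝ) h0
  rw [← (h2.unique h), ← toDual_gradient, InnerProductSpace.toDual_apply_apply]

theorem inner_gradient_newtonPotential {n d : ℕ} (m : Fin n → ℝ) {q : Configuration n d}
    (hq : ∀ i j, i ≠ j → q i ≠ q j) (v : Configuration n d) :
    inner ℝ (gradient (newtonPotential m) q) v =
      -∑ i, ∑ j ∈ Finset.Ioi i,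
        m i * m j * (1 / ‖q i - q j‖ ^ 3 * inner ℝ (q i - q j) (v i - v j)) := by
  refine inner_gradient_eq (differentiableAt_newtonPotential m hq) ?_
  unfold newtonPotential
  simp_rw [← Finset.sum_neg_distrib]
  refine HasDerivAt.fun_sum fun i _ => HasDerivAt.fun_sum fun j hj => ?_
  have hne : q i - q j ≠ 0 := sub_ne_zero.2 (hq i j (Finset.mem_Ioi.1 hj).ne)
  have e : (fun t : ℝ => m i * m j / ‖(q + t • v) i - (q + t • v) j‖) =
      fun t => m i * m j * (1 / ‖q i - q j + t • (v i - v j)‖) := by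
    funext t
    rw [mul_one_div, PiLp.add_apply, PiLp.add_apply, PiLp.smul_apply, PiLp.smul_apply, smul_sub,
      add_sub_add_comm]
  rw [e]
  exact ((hasDerivAt_inv_norm_line hne (v i - v j)).const_mul (m i * m j)).congr_deriv (by ring)

theorem inner_gradient_momentOfInertia {n d : ℕ} (m : Fin n → ℝ) (q v : Configuration n d) :
    inner ℝ (gradient (momentOfInertia m) q) v = ∑ i, m i * inner ℝ (q i) (v i) := by
  refine inner_gradient_eq (differentiableAt_momentOfInertia m q) ?_
  unfold momentOfInertia
  have h : ∀ i, HasDerivAt (fun t : ℝ => ‖(q + t • v) i‖ ^ 2) (2 * inner ℝ (q i) (v i)) 0 := by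
    intro i
    have h0 : HasDerivAt (fun t : ℝ => (q + t • v) i) (v i) 0 := by
      simpa using ((hasDerivAt_id (0 : ℝ)).smul_const (v i)).const_add (q i)
    simpa using h0.norm_sq
  refine ((HasDerivAt.fun_sum fun i (_ : i ∈ Finset.univ) =>
    (h i).const_mul (m i)).const_mul (1 / 2 : ℝ)).congr_deriv ?_
  rw [Finset.mul_sum]
  exact Finset.sum_congr rfl fun i _ => by ring

/-- The equations of central configurations of four bodies. -/
theorem IsCentralConfiguration.exists_force_eq {m : Fin 4 → ℝ} (hm : ∀ i, 0 < m i)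
    {d : ℕ} {q : Configuration 4 d} (hq : IsCentralConfiguration m q) :
    ∃ lam : ℝ, ∀ k, ∑ j, (m j * (1 / ‖q j - q k‖ ^ 3 - lam)) • (q j - q k) = 0 := by
  obtain ⟨lam, hlam⟩ := hq.critical
  have hM : 0 < ∑ j, m j := Finset.sum_pos (fun i _ => hm i) Finset.univ_nonempty
  -- With the centre of mass at 0 and total mass M, `lam` q_k = -(`lam`/M) ∑ m_j (q_j - q_k), which
  -- merges with the pairwise forces.
  refine ⟨lam / ∑ j, m j, fun k => ?_⟩
  have hcom : ∑ j, m j • (q j - q k) = -((∑ j, m j) • q k) := by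
    simp_rw [smul_sub]
    rw [Finset.sum_sub_distrib, hq.center_of_mass, ← Finset.sum_smul, zero_sub]
  have hforce : ∑ j, (m j * (1 / ‖q j - q k‖ ^ 3)) • (q j - q k) + lam • q k = 0 := by
    refine ext_inner_right ℝ fun w => ?_
    rw [inner_zero_left]
    -- Testing against a displacement of body k alone isolates the force on it.
    have h := congrArg (fun z => inner ℝ z
      (WithLp.toLp 2 (Function.update 0 k w) : Configuration 4 d)) hlam
    simp only [inner_add_left, inner_zero_left, inner_smul_left,
      inner_gradient_newtonPotential m hq.collision_free, inner_gradient_momentOfInertia] at h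
    have i0 : Finset.Ioi (0 : Fin 4) = {1, 2, 3} := rfl
    have i1 : Finset.Ioi (1 : Fin 4) = {2, 3} := rfl
    have i2 : Finset.Ioi (2 : Fin 4) = {3} := rfl
    have i3 : Finset.Ioi (3 : Fin 4) = ∅ := rfl
    rw [Fin.sum_univ_four, i0, i1, i2, i3] at h
    apply mul_left_cancel₀ (hm k).ne'
    rw [mul_zero, ← h]
    have n10 := norm_sub_rev (q 1) (q 0)
    have n20 := norm_sub_rev (q 2) (q 0)
    have n30 := norm_sub_rev (q 3) (q 0)
    have n21 := norm_sub_rev (q 2) (q 1)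
    have n31 := norm_sub_rev (q 3) (q 1)
    have n32 := norm_sub_rev (q 3) (q 2)
    fin_cases k <;>
      simp [Fin.sum_univ_four, inner_add_left, inner_sub_left, inner_sub_right, inner_smul_left,
        n10, n20, n30, n21, n31, n32, -one_div] <;> ring
  have h : ∀ j, (m j * (1 / ‖q j - q k‖ ^ 3 - lam / ∑ j, m j)) • (q j - q k) =
      (m j * (1 / ‖q j - q k‖ ^ 3)) • (q j - q k) -
        (lam / ∑ j, m j) • m j • (q j - q k) := fun j => by
    rw [smul_smul, ← sub_smul]
    congr 1
    ring
  rw [Finset.sum_congr rfl fun j _ => h j, Finset.sum_sub_distrib, ← Finset.smul_sum, hcom,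
    smul_neg, smul_smul, div_mul_cancel₀ _ hM.ne', sub_neg_eq_add, hforce]

/-! ### From trapezoids to the distance equations. -/

/-- The points `p 0, p 1, p 2, p 3` are consecutive vertices of a nondegenerate trapezoid whose
sides `p 0 p 1` and `p 3 p 2` are parallel. -/
def IsTrapezoidAlong (p : Fin 4 → EuclideanSpace ℝ (Fin 2)) (t : ℝ) : Prop :=
  0 < t ∧ p 2 - p 3 = t • (p 1 - p 0) ∧ LinearIndependent ℝ ![p 1 - p 0, p 3 - p 0]

/-- Of three collinear vertices one would lie between the others, against convexity; and for a
negative ratio the diagonals would not meet. -/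
theorem isTrapezoidAlong_of_parallel {p : Fin 4 → EuclideanSpace ℝ (Fin 2)}
    (hc : ∀ i, p i ∉ convexHull ℝ (p '' {i}ᶜ))
    (hd : (segment ℝ (p 0) (p 2) ∩ segment ℝ (p 1) (p 3)).Nonempty)
    (hp : line[ℝ, p 0, p 1] ∥ line[ℝ, p 2, p 3]) : ∃ t, IsTrapezoidAlong p t := by
  have hseg : ∀ i j k, i ≠ j → i ≠ k → ¬ Wbtw ℝ (p j) (p i) (p k) := fun i j k hj hk h =>
    hc i (segment_subset_convexHull (Set.mem_image_of_mem p (by simpa using hj.symm))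
      (Set.mem_image_of_mem p (by simpa using hk.symm)) (mem_segment_iff_wbtw.2 h))
  have hli : LinearIndependent ℝ ![p 1 - p 0, p 3 - p 0] := by
    by_contra hli
    have hcol : Collinear ℝ ({p 0, p 1, p 3} : Set (EuclideanSpace ℝ (Fin 2))) := by
      by_contra hcol
      apply hli
      have := affineIndependent_iff_not_collinear_set.2 hcol
      rw [affineIndependent_iff_linearIndependent_vsub ℝ _ (0 : Fin 3)] at this
      have h2 := this.comp (fun i : Fin 2 => ⟨i.succ, Fin.succ_ne_zero i⟩)
        (fun i j h => by simpa using h)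
      have e : ![p 1 - p 0, p 3 - p 0] = (fun i : {x : Fin 3 // x ≠ 0} =>
          ![p 0, p 1, p 3] i -ᵥ ![p 0, p 1, p 3] 0) ∘
          fun i : Fin 2 => ⟨i.succ, Fin.succ_ne_zero i⟩ := by
        funext i
        fin_cases i <;> simp
      rw [e]
      exact h2
    rcases hcol.wbtw_or_wbtw_or_wbtw with h | h | h
    · exact hseg _ _ _ (by decide) (by decide) h
    · exact hseg _ _ _ (by decide) (by decide) h
    · exact hseg _ _ _ (by decide) (by decide) h
  obtain ⟨s, hs⟩ := AffineSubspace.affineSpan_pair_parallel_iff_exists_unit_smul'.1 hp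
  have hs' : p 2 - p 3 = (-(s : ℝ)) • (p 1 - p 0) := by
    rw [neg_smul, ← Units.smul_def, ← neg_sub (p 3)]
    exact congrArg _ hs.symm
  refine ⟨-(s : ℝ), ?_, hs', hli⟩
  by_contra! ht
  obtain ⟨X, ⟨a, b, ha, hb, hab, hX⟩, a', b', ha', hb', hab', hX'⟩ := hd
  rw [LinearIndependent.pair_iff] at hli
  have h2 : p 2 = p 3 + (-(s : ℝ)) • (p 1 - p 0) := by rw [← hs']; abel
  have hcomb : (b * (-(s : ℝ)) - a') • (p 1 - p 0) + (b - b') • (p 3 - p 0) = 0 := by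
    obtain rfl : a = 1 - b := by linarith
    obtain rfl : a' = 1 - b' := by linarith
    rw [← hX', h2] at hX
    rw [← sub_eq_zero] at hX
    rw [← hX]
    module
  obtain ⟨e1, e2⟩ := hli _ _ hcomb
  have h3 : b * (-(s : ℝ)) ≤ 0 := mul_nonpos_of_nonneg_of_nonpos hb ht
  have h4 : b = 1 := by linarith
  have h5 : -(s : ℝ) = 0 := by rw [h4] at e1; linarith
  exact s.ne_zero (neg_eq_zero.1 h5)

theorem IsTrapezoid.exists_along {p : Fin 4 → EuclideanSpace ℝ (Fin 2)} (h : IsTrapezoid p) :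
    (∃ t, IsTrapezoidAlong p t) ∨ ∃ t, IsTrapezoidAlong (fun k => p (finRotate 4 k)) t := by
  rcases h.parallel_sides with hp | hp
  · exact Or.inl (isTrapezoidAlong_of_parallel h.convex h.diagonals_meet hp)
  · right
    refine isTrapezoidAlong_of_parallel (fun i hi => h.convex (finRotate 4 i) ?_) ?_ hp
    · refine convexHull_mono ?_ hi
      rintro _ ⟨k, hk, rfl⟩
      exact Set.mem_image_of_mem p fun h => hk ((finRotate 4).injective h)
    · obtain ⟨X, h1, h2⟩ := h.diagonals_meet
      exact ⟨X, h2, by rw [segment_symm]; exact h1⟩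

theorem IsTrapezoidAlong.rotate_of_parallelogram {p : Fin 4 → EuclideanSpace ℝ (Fin 2)}
    (h : IsTrapezoidAlong p 1) : IsTrapezoidAlong (fun k => p (finRotate 4 k)) 1 := by
  obtain ⟨-, h2, h3⟩ := h
  rw [one_smul] at h2
  rw [LinearIndependent.pair_iff] at h3
  refine ⟨one_pos, ?_, ?_⟩
  · change p 3 - p 0 = (1 : ℝ) • (p 2 - p 1)
    rw [one_smul, sub_eq_sub_iff_add_eq_add, add_comm, ← sub_eq_sub_iff_add_eq_add]
    rw [sub_eq_iff_eq_add] at h2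
    rw [h2]; abel
  · change LinearIndependent ℝ ![p 2 - p 1, p 0 - p 1]
    rw [LinearIndependent.pair_iff]
    intro s t hst
    have h4 := h3 (-t) s (by
      rw [← hst, sub_eq_iff_eq_add.1 h2]
      module)
    exact ⟨h4.2, neg_eq_zero.1 h4.1⟩

/-- The Dziobek equations of a trapezoid in equilibrium. -/
theorem IsTrapezoidAlong.exists_system {p : Fin 4 → EuclideanSpace ℝ (Fin 2)} {t : ℝ}
    (hp : IsTrapezoidAlong p t) {n : Fin 4 → ℝ} {lam : ℝ}
    (hf : ∀ k, ∑ j, (n j * (1 / ‖p j - p k‖ ^ 3 - lam)) • (p j - p k) = 0) :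
    ∃ T : TrapezoidSystem (n 0) (n 1) (n 2) (n 3) lam, T.x = ‖p 1 - p 0‖ ∧
      T.y = t * ‖p 1 - p 0‖ ∧ T.p = ‖p 3 - p 0‖ ∧ T.e = ‖p 3 - p 1‖ := by
  obtain ⟨ht, h2, hli⟩ := hp
  rw [LinearIndependent.pair_iff] at hli
  obtain ⟨v, hv⟩ : ∃ v, v = p 1 - p 0 := ⟨_, rfl⟩
  obtain ⟨w, hw⟩ : ∃ w, w = p 3 - p 0 := ⟨_, rfl⟩
  have d10 : p 1 - p 0 = v := hv.symm
  have d01 : p 0 - p 1 = -v := by rw [hv]; abel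
  have d30 : p 3 - p 0 = w := hw.symm
  have d03 : p 0 - p 3 = -w := by rw [hw]; abel
  rw [d10] at h2
  have d23 : p 2 - p 3 = t • v := h2
  have d32 : p 3 - p 2 = -(t • v) := by rw [← h2]; abel
  have d20 : p 2 - p 0 = w + t • v := by rw [← h2, hw]; abel
  have d02 : p 0 - p 2 = -(w + t • v) := by rw [← h2, hw]; abel
  have d31 : p 3 - p 1 = w - v := by rw [hv, hw]; abel
  have d13 : p 1 - p 3 = -(w - v) := by rw [hv, hw]; abel
  have d21 : p 2 - p 1 = w + t • v - v := by rw [← h2, hw, hv]; abel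
  have d12 : p 1 - p 2 = -(w + t • v - v) := by rw [← h2, hw, hv]; abel
  rw [d10, d30] at hli
  have f0 := hf 0
  have f1 := hf 1
  have f2 := hf 2
  have f3 := hf 3
  simp only [Fin.sum_univ_four, sub_self, smul_zero, zero_add, add_zero, d10, d01, d30, d03, d23,
    d32, d20, d02, d31, d13, d21, d12, norm_neg] at f0 f1 f2 f3
  have hne : ∀ a b : ℝ, (a ≠ 0 ∨ b ≠ 0) → a • v + b • w ≠ 0 := fun a b hab h => by
    have := hli a b h
    tauto
  have hv0 : v ≠ 0 := by simpa using hne 1 0 (by simp)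
  have hw0 : w ≠ 0 := by simpa using hne 0 1 (by simp)
  have hd0 : w + t • v ≠ 0 := by
    convert hne t 1 (by simp) using 1
    module
  have hq0 : w + t • v - v ≠ 0 := by
    convert hne (t - 1) 1 (by simp) using 1
    module
  have he0 : w - v ≠ 0 := by
    convert hne (-1) 1 (by simp) using 1
    module
  have hx0 : 0 < ‖v‖ := norm_pos_iff.2 hv0
  obtain ⟨u, hu⟩ : ∃ u, u * ‖v‖ = inner ℝ w v := ⟨inner ℝ w v / ‖v‖, by field_simp⟩
  have hh0 : w - (u / ‖v‖) • v ≠ 0 := by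
    convert hne (-(u / ‖v‖)) 1 (by simp) using 1
    module
  have nt : ‖t • v‖ = t * ‖v‖ := by rw [norm_smul, Real.norm_of_nonneg ht.le]
  have hh : ‖w‖ ^ 2 = u ^ 2 + ‖w - (u / ‖v‖) • v‖ ^ 2 := by
    rw [norm_sub_sq_real, inner_smul_right, norm_smul, ← hu, mul_pow, Real.norm_eq_abs, sq_abs]
    field_simp
    ring
  -- The forces at three vertices, read in the basis v, w, give six scalar equations from which the
  -- system follows.
  have a0 := hli (n 1 * (1 / ‖v‖ ^ 3 - lam) + t * (n 2 * (1 / ‖w + t • v‖ ^ 3 - lam)))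
    (n 2 * (1 / ‖w + t • v‖ ^ 3 - lam) + n 3 * (1 / ‖w‖ ^ 3 - lam)) (by rw [← f0]; module)
  have a1 := hli (-(n 0 * (1 / ‖v‖ ^ 3 - lam)) + (t - 1) * (n 2 * (1 / ‖w + t • v - v‖ ^ 3 - lam))
      - n 3 * (1 / ‖w - v‖ ^ 3 - lam))
    (n 2 * (1 / ‖w + t • v - v‖ ^ 3 - lam) + n 3 * (1 / ‖w - v‖ ^ 3 - lam))
    (by rw [← f1]; module)
  have a3 := hli (n 1 * (1 / ‖w - v‖ ^ 3 - lam) + t * (n 2 * (1 / ‖t • v‖ ^ 3 - lam)))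
    (-(n 0 * (1 / ‖w‖ ^ 3 - lam)) - n 1 * (1 / ‖w - v‖ ^ 3 - lam)) (by rw [← f3]; module)
  rw [nt] at a3
  refine ⟨{ x := ‖v‖, y := t * ‖v‖, p := ‖w‖, q := ‖w + t • v - v‖, d := ‖w + t • v‖,
            e := ‖w - v‖, u := u, h := ‖w - (u / ‖v‖) • v‖,
            P := n 0 * n 3 * (1 / ‖w‖ ^ 3 - lam),
            x_pos := hx0, y_pos := by positivity, p_pos := norm_pos_iff.2 hw0,
            q_pos := norm_pos_iff.2 hq0, d_pos := norm_pos_iff.2 hd0,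
            e_pos := norm_pos_iff.2 he0, h_pos := norm_pos_iff.2 hh0,
            p_sq := hh, q_sq := ?_, d_sq := ?_, e_sq := ?_, eq_p := rfl,
            eq_q := ?_, eq_d := ?_, eq_e := ?_, eq_x := ?_, eq_y := ?_ },
            by rw [d10], by rw [d10], by rw [d30], by rw [d31]⟩
  · have e : w + t • v - v = w + (t - 1) • v := by module
    rw [e, norm_add_sq_real, inner_smul_right, norm_smul, ← hu, mul_pow, Real.norm_eq_abs, sq_abs]
    linear_combination hh
  · rw [norm_add_sq_real, inner_smul_right, nt, ← hu]
    linear_combination hh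
  · rw [norm_sub_sq_real, ← hu]
    linear_combination hh
  · linear_combination n 1 * a1.2 + n 3 * a3.2
  · linear_combination n 0 * a0.2
  · linear_combination -n 3 * a3.2
  · linear_combination n 0 * ‖v‖ * a0.1 - n 0 * t * ‖v‖ * a0.2
  · linear_combination n 3 * ‖v‖ * a3.1 + n 3 * ‖v‖ * a3.2

/-! ### From distances back to configurations. -/

/-- Equal side lengths give equal Gram matrices, so the linear map v ↦ v', w ↦ w' preserves norms.
-/
theorem exists_linearIsometryEquiv_of_norm_eq {E : Type*} [NormedAddCommGroup E]
    [InnerProductSpace ℝ E] (hE : Module.finrank ℝ E = 2) {v w v' w' : E}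
    (hli : LinearIndependent ℝ ![v, w]) (hv : ‖v'‖ = ‖v‖) (hw : ‖w'‖ = ‖w‖)
    (hvw : ‖w' - v'‖ = ‖w - v‖) : ∃ A : E ≃ₗᵢ[ℝ] E, A v = v' ∧ A w = w' := by
  have : FiniteDimensional ℝ E := Module.finite_of_finrank_eq_succ hE
  let B := basisOfLinearIndependentOfCardEqFinrank hli (by simp [hE])
  have hB0 : B 0 = v := by simp [B]
  have hB1 : B 1 = w := by simp [B]
  let f : E →ₗ[ℝ] E := B.constr ℝ ![v', w']
  have hf0 : f v = v' := by rw [← hB0]; simp [f]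
  have hf1 : f w = w' := by rw [← hB1]; simp [f]
  have hin : inner ℝ w' v' = inner ℝ w v := by
    have h1 := norm_sub_sq_real w' v'
    have h2 := norm_sub_sq_real w v
    rw [hvw, hv, hw] at h1
    linarith
  have hnorm : ∀ z, ‖f z‖ = ‖z‖ := by
    intro z
    have hz : z = B.repr z 0 • v + B.repr z 1 • w := by
      conv_lhs => rw [← B.sum_repr z, Fin.sum_univ_two, hB0, hB1]
    generalize B.repr z 0 = a at hz
    generalize B.repr z 1 = b at hz
    rw [← sq_eq_sq₀ (norm_nonneg _) (norm_nonneg _), hz, map_add, map_smul, map_smul, hf0, hf1,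
      norm_add_sq_real, norm_add_sq_real, inner_smul_left, inner_smul_right, inner_smul_left,
      inner_smul_right, norm_smul, norm_smul, norm_smul, norm_smul, hv, hw,
      real_inner_comm w' v', real_inner_comm w v, hin]
  exact ⟨LinearIsometry.toLinearIsometryEquiv ⟨f, hnorm⟩ rfl, hf0, hf1⟩

/-- The mutual distances of a trapezoidal central configuration. -/
theorem IsCentralConfiguration.exists_system {m : Fin 4 → ℝ} (hm : ∀ i, 0 < m i)
    (σ : Equiv.Perm (Fin 4)) {q : Configuration 4 2} (hq : IsCentralConfiguration m q) {t : ℝ}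
    (ht : IsTrapezoidAlong (fun k => q (σ k)) t) :
    ∃ (lam : ℝ) (T : TrapezoidSystem (m (σ 0)) (m (σ 1)) (m (σ 2)) (m (σ 3)) lam),
      T.x = ‖q (σ 1) - q (σ 0)‖ ∧ T.y = t * ‖q (σ 1) - q (σ 0)‖ ∧
      T.p = ‖q (σ 3) - q (σ 0)‖ ∧ T.e = ‖q (σ 3) - q (σ 1)‖ := by
  obtain ⟨lam, hf⟩ := hq.exists_force_eq hm
  refine ⟨lam, ht.exists_system (n := fun k => m (σ k)) fun k => ?_⟩
  rw [← hf (σ k)]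
  exact Equiv.sum_comp σ fun j => (m j * (1 / ‖q j - q (σ k)‖ ^ 3 - lam)) • (q j - q (σ k))

/-- Trapezoidal central configurations with the same pair of parallel sides are equivalent. -/
theorem configEquiv_of_along {m : Fin 4 → ℝ} (hm : ∀ i, 0 < m i) (σ : Equiv.Perm (Fin 4))
    {q q' : Configuration 4 2} (hq : IsCentralConfiguration m q)
    (hq' : IsCentralConfiguration m q') {t t' : ℝ} (ht : IsTrapezoidAlong (fun k => q (σ k)) t)
    (ht' : IsTrapezoidAlong (fun k => q' (σ k)) t') : ConfigEquiv q q' := by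
  obtain ⟨lam, T, hx, hy, hp, he⟩ := hq.exists_system hm σ ht
  obtain ⟨lam', T', hx', hy', hp', he'⟩ := hq'.exists_system hm σ ht'
  obtain ⟨c, hc, ex, ey, ep, ee⟩ := T.exists_proportional T' (hm _) (hm _) (hm _) (hm _)
  rw [hx, hx'] at ex
  rw [hy, hy', ex] at ey
  rw [hp, hp'] at ep
  rw [he, he'] at ee
  obtain ⟨-, h2, hli⟩ := ht
  obtain ⟨-, h2', -⟩ := ht'
  have hx0 : 0 < ‖q (σ 1) - q (σ 0)‖ := by rw [← hx]; exact T.x_pos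
  obtain rfl : t' = t := by
    apply mul_right_cancel₀ (mul_pos hc hx0).ne'
    linarith
  -- The isometry matches the triangles of bodies σ 0, σ 1, σ 3; the body σ 2 then follows from the
  -- common ratio t.
  obtain ⟨A, hA1, hA3⟩ := exists_linearIsometryEquiv_of_norm_eq
    (v' := c⁻¹ • (q' (σ 1) - q' (σ 0))) (w' := c⁻¹ • (q' (σ 3) - q' (σ 0))) (by simp) hli
    (by rw [norm_smul, ex, Real.norm_of_nonneg (by positivity)]; field_simp)
    (by rw [norm_smul, ep, Real.norm_of_nonneg (by positivity)]; field_simp)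
    (by rw [← smul_sub, sub_sub_sub_cancel_right, sub_sub_sub_cancel_right, norm_smul, ee,
      Real.norm_of_nonneg (by positivity)]; field_simp)
  rw [eq_inv_smul_iff₀ hc.ne', map_sub] at hA1 hA3
  have hrel : ∀ k, q' (σ k) - c • A (q (σ k)) = q' (σ 0) - c • A (q (σ 0)) := by
    have h3 : q' (σ 3) - c • A (q (σ 3)) = q' (σ 0) - c • A (q (σ 0)) := by
      rw [sub_eq_sub_iff_sub_eq_sub, ← hA3, smul_sub]
    have h1 : q' (σ 1) - c • A (q (σ 1)) = q' (σ 0) - c • A (q (σ 0)) := by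
      rw [sub_eq_sub_iff_sub_eq_sub, ← hA1, smul_sub]
    have h2A := congrArg (fun z => c • A z) h2
    simp only [map_sub, map_smul] at h2A
    rw [smul_comm c, hA1, ← h2', smul_sub, sub_eq_sub_iff_sub_eq_sub] at h2A
    intro k
    fin_cases k
    · rfl
    · exact h1
    · change q' (σ 2) - c • A (q (σ 2)) = _
      rw [← h3, ← neg_sub, h2A, neg_sub]
    · exact h3
  -- The remaining translation vanishes because both centres of mass are at the origin.
  have hzero : q' (σ 0) - c • A (q (σ 0)) = 0 := by
    have hM : 0 < ∑ k, m k := Finset.sum_pos (fun i _ => hm i) Finset.univ_nonempty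
    have hall : ∀ i, q' i - c • A (q i) = q' (σ 0) - c • A (q (σ 0)) := fun i => by
      simpa using hrel (σ.symm i)
    have h := congrArg (fun z => c • A z) hq.center_of_mass
    simp only [map_sum, map_smul, map_zero, smul_zero, Finset.smul_sum] at h
    have hs : ∑ i, m i • (q' i - c • A (q i)) = 0 := by
      simp_rw [smul_sub, smul_comm (m _) c]
      rw [Finset.sum_sub_distrib, hq'.center_of_mass, h, sub_zero]
    simp_rw [hall] at hs
    rw [← Finset.sum_smul] at hs
    exact (smul_eq_zero.1 hs).resolve_left hM.ne'
  refine ⟨A, c, hc, fun i => ?_⟩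
  have := hrel (σ.symm i)
  rw [hzero, sub_eq_zero] at this
  simpa using this

/-- If the parallel sides differ, one of the trapezoids is a parallelogram, and the previous
case applies. -/
theorem configEquiv_of_mixed {m : Fin 4 → ℝ} (hm : ∀ i, 0 < m i) (σ : Equiv.Perm (Fin 4))
    {q q' : Configuration 4 2} (hq : IsCentralConfiguration m q)
    (hq' : IsCentralConfiguration m q') {t t' : ℝ} (ht : IsTrapezoidAlong (fun k => q (σ k)) t)
    (ht' : IsTrapezoidAlong (fun k => q' (σ (finRotate 4 k))) t') : ConfigEquiv q q' := by
  obtain ⟨lam, T, hx, hy, -⟩ := hq.exists_system hm σ ht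
  obtain ⟨lam', T', hx', hy', -⟩ := hq'.exists_system hm ((finRotate 4).trans σ) ht'
  rcases T.parallelogram_of_mixed T' (hm _) (hm _) (hm _) (hm _) with h | h
  · obtain rfl : t = 1 := by
      apply mul_right_cancel₀ T.x_pos.ne'
      rw [hx, ← hy, ← h, one_mul, hx]
    exact configEquiv_of_along hm ((finRotate 4).trans σ) hq hq' ht.rotate_of_parallelogram ht'
  · obtain rfl : t' = 1 := by
      apply mul_right_cancel₀ T'.x_pos.ne'
      rw [hx', ← hy', ← h, one_mul, hx']
    -- One rotation is already present in `ht'`; three more complete the full turn.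
    have h1 := ht'.rotate_of_parallelogram.rotate_of_parallelogram.rotate_of_parallelogram
    refine configEquiv_of_along hm σ hq hq' ht (t' := 1) ?_
    convert h1 using 3 with k
    fin_cases k <;> rfl

theorem ConfigEquiv.symm {n d : ℕ} {q q' : Configuration n d} (h : ConfigEquiv q q') :
    ConfigEquiv q' q := by
  obtain ⟨A, c, hc, h⟩ := h
  refine ⟨A.symm, c⁻¹, inv_pos.2 hc, fun i => ?_⟩
  rw [h i, map_smul, A.symm_apply_apply, inv_smul_smul₀ hc.ne']

theorem theorem1 (m : Fin 4 → ℝ) (hm : ∀ i, 0 < m i) (σ : Equiv.Perm (Fin 4))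
    (q q' : Configuration 4 2) (hq : IsTrapezoidalCC m σ q) (hq' : IsTrapezoidalCC m σ q') :
    ConfigEquiv q q' := by
  obtain ⟨hc, ht⟩ := hq
  obtain ⟨hc', ht'⟩ := hq'
  rcases ht.exists_along with ⟨t, ht⟩ | ⟨t, ht⟩ <;>
    rcases ht'.exists_along with ⟨t', ht'⟩ | ⟨t', ht'⟩
  · exact configEquiv_of_along hm σ hc hc' ht ht'
  · exact configEquiv_of_mixed hm σ hc hc' ht ht'
  · exact (configEquiv_of_mixed hm σ hc' hc ht' ht).symm
  · exact configEquiv_of_along hm ((finRotate 4).trans σ) hc hc' ht ht'
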